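/- Let $A$ be a finite-dimensional algebra over a field and let $\mathscr{A}=A\text{-mod}$ be the category of finitely generated left $A$-modules. Let $\mathscr{C}$ be a full additive subcategory of $\mathscr{A}$, closed under direct summands, which is contravariantly finite (every $M\in\mathscr{A}$ has a right $\mathscr{C}$-approximation, i.e. a morphism $C\to M$ with $C\in\mathscr{C}$ through which every morphism from an object of $\mathscr{C}$ to $M$ factors) and admissible (every right $\mathscr{C}$-approximation is an epimorphism). A complex $X^\bullet$ is called $\mathrm{Hom}_{\mathscr{A}}(\mathscr{C},-)$-exact (resp. $\mathrm{Hom}_{\mathscr{A}}(-,\mathscr{C})$-exact) if $\mathrm{Hom}_{\mathscr{A}}(C,X^\bullet)$ (resp. $\mathrm{Hom}_{\mathscr{A}}(X^\bullet,C)$) is acyclic for all $C\in\mathscr{C}$. Let $D^b_{\mathscr{C}}(\mathscr{A})$ be the Verdier quotient of the bounded homotopy category $K^b(\mathscr{A})$ by the $\mathrm{Hom}_{\mathscr{A}}(\mathscr{C},-)$-exact complexes, and let $D_{\mathscr{C}\text{-}sg}(\mathscr{A})=D^b_{\mathscr{C}}(\mathscr{A})/K^b(\mathscr{C})$ be the Verdier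 quotient by the full subcategory of objects isomorphic in $D^b_{\mathscr{C}}(\mathscr{A})$ to bounded complexes over $\mathscr{C}$. Let $\mathscr{G}(\mathscr{C})$ be the full subcategory of $\mathscr{A}$ of all objects isomorphic to $\mathrm{Im}(C^{-1}\to C^0)$ for some acyclic complex $C^\bullet$ of objects of $\mathscr{C}$ that is both $\mathrm{Hom}_{\mathscr{A}}(\mathscr{C},-)$-exact and $\mathrm{Hom}_{\mathscr{A}}(-,\mathscr{C})$-exact, and let $\varepsilon$ be the class of $\mathrm{Hom}_{\mathscr{A}}(\mathscr{C},-)$-exact complexes $0\to L\to M\to N\to 0$ with $L,M,N\in\mathscr{G}(\mathscr{C})$. The stable category $\underline{\mathscr{G}(\mathscr{C})}$ has the objects of $\mathscr{G}(\mathscr{C})$, and its morphisms are those of $\mathscr{G}(\mathscr{C})$ modulo the morphisms that factor through an object of $\mathscr{C}$. It carries the usual triangulated structure of the stable category of a Frobenius category: for each $X$ choose a sequence $0\to X\to I(X)\to SX\to 0$ in $\varepsilon$ with $I(X)\in\mathscr{C}$; the suspension is $X\mapsto SX$, and the distinguished triangles are those isomorphic to a triangle $X\xrightarrow{u}Y\xrightarrow{v}Z\xrightarrow{w}SX$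 where $u$ is a morphism of $\mathscr{G}(\mathscr{C})$, $Z$ is the pushout of $X\to I(X)$ along $u$, and $w$ is induced by $I(X)\to SX$ and $0:Y\to SX$. Let $\theta:\mathscr{G}(\mathscr{C})\to D_{\mathscr{C}\text{-}sg}(\mathscr{A})$ be the composition $\mathscr{G}(\mathscr{C})\hookrightarrow\mathscr{A}\to D^b_{\mathscr{C}}(\mathscr{A})\to D_{\mathscr{C}\text{-}sg}(\mathscr{A})$ (an object of $\mathscr{A}$ being viewed as a complex concentrated in degree $0$), and let $\theta':\underline{\mathscr{G}(\mathscr{C})}\to D_{\mathscr{C}\text{-}sg}(\mathscr{A})$ be the functor induced by $\theta$. Then: 1. $\theta$ is a $\partial$-functor: it is additive, and for all $L\xrightarrow{i}M\xrightarrow{p}N$ in $\varepsilon$ there are morphisms $\omega_{(i,p)}:\theta(N)\to\theta(L)[1]$, functorial with respect to morphisms of sequences in $\varepsilon$, such that $\theta(L)\xrightarrow{\theta(i)}\theta(M)\xrightarrow{\theta(p)}\theta(N)\xrightarrow{\omega_{(i,p)}}\theta(L)[1]$ is a distinguished triangle. 2. $\theta(C)=0$ for every $C\in\mathscr{C}$.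 3. $\theta'$ is a triangle functor: it is additive, and there is a natural isomorphism $\omega:\theta' S\cong[1]\theta'$ such that for every distinguished triangle $X\xrightarrow{u}Y\xrightarrow{v}Z\xrightarrow{w}SX$ of $\underline{\mathscr{G}(\mathscr{C})}$ the triangle $\theta'X\xrightarrow{\theta'u}\theta'Y\xrightarrow{\theta'v}\theta'Z\xrightarrow{\omega_X\circ\theta'w}(\theta'X)[1]$ is distinguished. -/

import Mathlib

open CategoryTheory CategoryTheory.Limits CategoryTheory.Pretriangulated Opposite
open scoped ZeroObject

universe v u

noncomputable section

namespace RelSing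

section

variable {𝒜 : Type u} [Category.{v} 𝒜] (C : ObjectProperty 𝒜)

/-- A morphism `f : X ⟶ M` with `X` in `C` through which every morphism from an object
of `C` to `M` factors. -/
def IsRightApproximation {X M : 𝒜} (f : X ⟶ M) : Prop :=
  C X ∧ ∀ ⦃X' : 𝒜⦄, C X' → ∀ g : X' ⟶ M, ∃ h : X' ⟶ X, h ≫ f = g

/-- `C` is contravariantly finite in `𝒜`: every object has a right `C`-approximation. -/
def IsContravariantlyFinite : Prop :=
  ∀ M : 𝒜, ∃ (X : 𝒜) (f : X ⟶ M), IsRightApproximation C f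

/-- `C` is admissible: it is contravariantly finite and every right `C`-approximation is epic. -/
def IsAdmissible : Prop :=
  IsContravariantlyFinite C ∧
    ∀ ⦃X M : 𝒜⦄ (f : X ⟶ M), IsRightApproximation C f → Epi f

end

variable {𝒜 : Type u} [Category.{v} 𝒜] [Abelian 𝒜] (C : ObjectProperty 𝒜)

/-- `K` is `Hom(C, -)`-exact (also called `C`-acyclic): the complex of abelian groups
`Hom(X, K)` is acyclic for all `X` in `C`. -/
def HomFromExact (K : CochainComplex 𝒜 ℤ) : Prop :=
  ∀ ⦃X : 𝒜⦄, C X →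
    (((preadditiveCoyoneda.obj (op X)).mapHomologicalComplex (ComplexShape.up ℤ)).obj K).Acyclic

/-- `K` is `Hom(-, C)`-exact: the complex of abelian groups `Hom(K, X)` is acyclic for all
`X` in `C`. -/
def HomToExact (K : CochainComplex 𝒜 ℤ) : Prop :=
  ∀ ⦃X : 𝒜⦄, C X →
    (((preadditiveYoneda.obj X).mapHomologicalComplex (ComplexShape.up ℤ).symm).obj K.op).Acyclic

variable {C} in
lemma HomFromExact.exists_lift {K : CochainComplex 𝒜 ℤ} (h : HomFromExact C K) {X : 𝒜}
    (hX : C X) {i j k : ℤ} (hij : i + 1 = j) (hjk : j + 1 = k) (f : X ⟶ K.X j)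
    (hf : f ≫ K.d j k = 0) : ∃ g : X ⟶ K.X i, g ≫ K.d i j = f := by
  have h1 := (HomologicalComplex.exactAt_iff' _ i j k (by simp; omega) (by simp; omega)).1 (h hX j)
  rw [ShortComplex.ab_exact_iff] at h1
  exact h1 f hf

variable {C} in
lemma homFromExact_of_exists_lift {K : CochainComplex 𝒜 ℤ}
    (h : ∀ ⦃X : 𝒜⦄, C X → ∀ (j : ℤ) (f : X ⟶ K.X j), f ≫ K.d j (j + 1) = 0 →
      ∃ g : X ⟶ K.X (j - 1), g ≫ K.d (j - 1) j = f) : HomFromExact C K := by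
  intro X hX j
  rw [HomologicalComplex.exactAt_iff' _ (j - 1) j (j + 1) (by simp) (by simp),
    ShortComplex.ab_exact_iff]
  exact fun f hf => h hX j f hf

variable {C} in
lemma HomToExact.exists_desc {K : CochainComplex 𝒜 ℤ} (h : HomToExact C K) {X : 𝒜}
    (hX : C X) {i j k : ℤ} (hij : i + 1 = j) (hjk : j + 1 = k) (f : K.X j ⟶ X)
    (hf : K.d i j ≫ f = 0) : ∃ g : K.X k ⟶ X, K.d j k ≫ g = f := by
  have h1 := (HomologicalComplex.exactAt_iff' _ k j i
    (ComplexShape.prev_eq' _ hjk) (ComplexShape.next_eq' _ hij)).1 (h hX j)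
  rw [ShortComplex.ab_exact_iff] at h1
  exact h1 f hf

variable {C} in
lemma homToExact_of_exists_desc {K : CochainComplex 𝒜 ℤ}
    (h : ∀ ⦃X : 𝒜⦄, C X → ∀ (j : ℤ) (f : K.X j ⟶ X), K.d (j - 1) j ≫ f = 0 →
      ∃ g : K.X (j + 1) ⟶ X, K.d j (j + 1) ≫ g = f) : HomToExact C K := by
  intro X hX j
  rw [HomologicalComplex.exactAt_iff' _ (j + 1) j (j - 1)
    (ComplexShape.prev_eq' _ rfl) (ComplexShape.next_eq' _ (sub_add_cancel j 1)),
    ShortComplex.ab_exact_iff]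
  exact fun f hf => h hX j f hf

/-! ### The bounded homotopy category and the bounded `C`-derived category -/

variable (𝒜) in
/-- The (classes of) bounded complexes in the homotopy category. -/
def bounded : ObjectProperty (HomotopyCategory 𝒜 (ComplexShape.up ℤ)) :=
  fun K => ∃ a b : ℤ, ∀ n : ℤ, (n < a ∨ b < n) → IsZero (K.as.X n)

lemma isZero_mappingCone {K L : CochainComplex 𝒜 ℤ} (f : K ⟶ L) {n : ℤ}
    (h₁ : IsZero (K.X (n + 1))) (h₂ : IsZero (L.X n)) :
    IsZero ((CochainComplex.mappingCone f).X n) := by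
  rw [CochainComplex.mappingCone.isZero_X_iff]
  exact ⟨h₁, h₂⟩

instance : (bounded 𝒜).ContainsZero where
  exists_zero := ⟨(HomotopyCategory.quotient _ _).obj 0,
    Functor.map_isZero _ (isZero_zero _), 0, 0, fun n _ =>
      (HomologicalComplex.eval 𝒜 (ComplexShape.up ℤ) n).map_isZero (isZero_zero _)⟩

instance : (bounded 𝒜).IsStableUnderShift ℤ where
  isStableUnderShiftBy n :=
    { le_shift := by
        rintro K ⟨a, b, h⟩
        obtain ⟨K : CochainComplex _ _, rfl⟩ := K.quotient_obj_surjective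
        rw [ObjectProperty.prop_shift_iff, HomotopyCategory.shift_quotient_obj]
        refine ⟨a - n, b - n, fun i hi => ?_⟩
        exact h (i + n) (by omega) }

/-- The third vertex of a distinguished triangle in the homotopy category is homotopy equivalent
to the cone of a representative of the first morphism. -/
lemma exists_iso_mappingCone (T : Triangle (HomotopyCategory 𝒜 (ComplexShape.up ℤ)))
    (hT : T ∈ distTriang _) : ∃ f : T.obj₁.as ⟶ T.obj₂.as,
      Nonempty (T.obj₃ ≅ (HomotopyCategory.quotient _ _).obj (CochainComplex.mappingCone f)) := by
  obtain ⟨f : T.obj₁.as ⟶ T.obj₂.as, hf⟩ :=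
    (HomotopyCategory.quotient 𝒜 (ComplexShape.up ℤ)).map_surjective T.mor₁
  refine ⟨f, ⟨Triangle.π₃.mapIso (isoTriangleOfIso₁₂ T _ hT
    (HomotopyCategory.mappingCone_triangleh_distinguished f) (Iso.refl _) (Iso.refl _) ?_)⟩⟩
  erw [Category.comp_id, Category.id_comp]
  exact hf.symm

instance : (bounded 𝒜).IsTriangulatedClosed₃ where
  ext₃' T hT := by
    rintro ⟨a, b, h⟩ ⟨a', b', h'⟩
    obtain ⟨f, ⟨e⟩⟩ := exists_iso_mappingCone T hT
    refine ⟨_, ⟨min (a - 1) a', max b b', fun n hn => ?_⟩, ⟨e⟩⟩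
    exact isZero_mappingCone f (h _ (by omega)) (h' _ (by omega))

instance : (bounded 𝒜).IsTriangulated where
  toIsTriangulatedClosed₂ := .of_isTriangulatedClosed₃

variable (𝒜) in
/-- The bounded homotopy category `K^b(𝒜)`. -/
abbrev Kb := (bounded 𝒜).FullSubcategory

/-- The `C`-acyclic complexes in `K^b(𝒜)`. -/
def acyclic : ObjectProperty (Kb 𝒜) := fun K => HomFromExact C K.obj.as

/-- `C`-acyclicity as vanishing under homological functors. -/
lemma acyclic_iff (K : Kb 𝒜) : acyclic C K ↔ ∀ ⦃X : 𝒜⦄, C X →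
    ((HomotopyCategory.subcategoryAcyclic AddCommGrpCat.{v}).inverseImage
      ((bounded 𝒜).ι ⋙ (preadditiveCoyoneda.obj (op X)).mapHomotopyCategory
        (ComplexShape.up ℤ))) K := by
  refine forall_congr' fun X => forall_congr' fun _ => ?_
  exact (HomotopyCategory.quotient_obj_mem_subcategoryAcyclic_iff_acyclic _).symm

instance : (acyclic C).IsClosedUnderIsomorphisms where
  of_iso e h := by
    rw [acyclic_iff] at h ⊢
    exact fun X hX => ObjectProperty.prop_of_iso _ e (h hX)

instance : (acyclic C).IsTriangulated where
  exists_zero := by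
    refine ⟨0, isZero_zero _, ?_⟩
    rw [acyclic_iff]
    exact fun X _ => ObjectProperty.prop_zero _
  isStableUnderShiftBy n :=
    { le_shift := fun K h => by
        rw [ObjectProperty.prop_shift_iff, acyclic_iff]
        rw [acyclic_iff] at h
        exact fun X hX => ObjectProperty.le_shift _ n _ (h hX) }
  toIsTriangulatedClosed₂ := .mk' (fun T hT h₁ h₃ => by
    rw [acyclic_iff] at h₁ h₃ ⊢
    exact fun X hX => ObjectProperty.ext_of_isTriangulatedClosed₂ _ T hT (h₁ hX) (h₃ hX))

/-- The bounded `C`-derived category `D^b_C(𝒜)`: the Verdier quotient of `K^b(𝒜)` by the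
`C`-acyclic complexes. -/
abbrev DbC := (acyclic C).trW.Localization

/-- The quotient functor `K^b(𝒜) ⥤ D^b_C(𝒜)`. -/
abbrev Qb : Kb 𝒜 ⥤ DbC C := (acyclic C).trW.Q


/-! ### `K^b(C)` and the `C`-singularity category -/

/-- The (classes of) bounded complexes of objects of `C` in the homotopy category. -/
def boundedOf : ObjectProperty (HomotopyCategory 𝒜 (ComplexShape.up ℤ)) :=
  fun K => (∃ a b : ℤ, ∀ n : ℤ, (n < a ∨ b < n) → IsZero (K.as.X n)) ∧ ∀ n : ℤ, C (K.as.X n)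

/-- `K^b(C)` as a (strictly) full subcategory of `K^b(𝒜)`. -/
def KbOf : ObjectProperty (Kb 𝒜) := (boundedOf C).isoClosure.inverseImage (bounded 𝒜).ι

lemma exists_homotopic_vanishing {K N : CochainComplex 𝒜 ℤ} (hK : ∀ n, C (K.X n))
    (hN : HomFromExact C N) (b : ℤ) (hb : ∀ n, b < n → IsZero (K.X n)) (f : K ⟶ N) (m : ℕ) :
    ∃ g : K ⟶ N, (HomotopyCategory.quotient 𝒜 (ComplexShape.up ℤ)).map f =
      (HomotopyCategory.quotient 𝒜 (ComplexShape.up ℤ)).map g ∧ ∀ i : ℤ, b - m < i → g.f i = 0 := by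
  induction m with
  | zero => exact ⟨f, rfl, fun i hi => (hb i (by simpa using hi)).eq_of_src _ _⟩
  | succ m ih =>
    obtain ⟨g, h, hg⟩ := ih
    obtain ⟨k, hk⟩ := hN.exists_lift (hK (b - m)) (i := b - m - 1) (k := b - m + 1)
      (by omega) rfl (g.f (b - m)) (by
        rw [HomologicalComplex.Hom.comm, hg _ (by omega), comp_zero])
    let e : ∀ i j : ℤ, (ComplexShape.up ℤ).Rel j i → (K.X i ⟶ N.X j) := fun i j hij =>
      if hi : i = b - m then
        eqToHom (by rw [hi]) ≫ k ≫ eqToHom (by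
          have : j = b - m - 1 := by have : j + 1 = i := hij; omega
          rw [this])
      else 0
    refine ⟨g - Homotopy.nullHomotopicMap' e, ?_, fun i hi => ?_⟩
    · rw [h, Functor.map_sub, HomotopyCategory.eq_of_homotopy _ _ (Homotopy.nullHomotopy' e),
        Functor.map_zero, sub_zero]
    · have r₁ : (ComplexShape.up ℤ).Rel (i - 1) i := sub_add_cancel i 1
      have r₂ : (ComplexShape.up ℤ).Rel i (i + 1) := rfl
      rw [HomologicalComplex.sub_f_apply, Homotopy.nullHomotopicMap'_f r₁ r₂]
      have e₁ : e (i + 1) i r₂ = 0 := dif_neg (by push_cast at hi; omega)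
      rw [e₁, comp_zero, zero_add]
      by_cases hi' : i = b - m
      · subst hi'
        have e₂ : e (b - m) (b - m - 1) r₁ = k := by
          simp [e]
        rw [e₂, hk, sub_self]
      · have e₂ : e i (i - 1) r₁ = 0 := dif_neg hi'
        rw [e₂, zero_comp, sub_zero, hg i (by push_cast at hi; omega)]

/-- There are no nonzero morphisms from `K^b(C)` to `C`-acyclic complexes. -/
lemma eq_zero_of_acyclic {K N : Kb 𝒜} (hK : KbOf C K) (hN : acyclic C N) (f : K ⟶ N) : f = 0 := by
  obtain ⟨L, ⟨⟨a, b, hab⟩, hL⟩, ⟨e⟩⟩ := hK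
  obtain ⟨f₀ : L.as ⟶ N.obj.as, hf₀⟩ :=
    (HomotopyCategory.quotient 𝒜 (ComplexShape.up ℤ)).map_surjective (e.inv ≫ f.hom)
  obtain ⟨g, h, hg⟩ := exists_homotopic_vanishing C hL hN b (fun n hn => hab n (Or.inr hn)) f₀
    (b - a + 1).toNat
  have hg0 : g = 0 := by
    ext i
    by_cases hi : b - (b - a + 1).toNat < i
    · exact hg i hi
    · exact (hab i (Or.inl (by omega))).eq_of_src _ _
  have h0 : e.inv ≫ f.hom = 0 := by
    refine hf₀.symm.trans (h.trans ?_)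
    rw [hg0, Functor.map_zero]
    rfl
  apply ObjectProperty.hom_ext
  rw [← cancel_epi e.inv]
  exact h0.trans comp_zero.symm

lemma boundedOf_isStableUnderShift : (boundedOf C).IsStableUnderShift ℤ where
  isStableUnderShiftBy n :=
    { le_shift := by
        rintro K ⟨⟨a, b, h⟩, hC⟩
        obtain ⟨K : CochainComplex _ _, rfl⟩ := K.quotient_obj_surjective
        rw [ObjectProperty.prop_shift_iff, HomotopyCategory.shift_quotient_obj]
        exact ⟨⟨a - n, b - n, fun i hi => h (i + n) (by omega)⟩, fun i => hC (i + n)⟩ }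

section

variable [C.IsClosedUnderFiniteProducts]

lemma prop_mappingCone {K L : CochainComplex 𝒜 ℤ} (f : K ⟶ L) (hK : ∀ n, C (K.X n))
    (hL : ∀ n, C (L.X n)) (n : ℤ) : C ((CochainComplex.mappingCone f).X n) := by
  have := ObjectProperty.IsClosedUnderBinaryProducts.closedUnderIsomorphisms C
  refine C.prop_of_iso (HomologicalComplex.homotopyCofiber.XIsoBiprod f n (n + 1) rfl).symm ?_
  exact C.prop_of_iso (biprod.isoProd _ _).symm (C.prop_prod _ _ (hK _) (hL _))

instance : (boundedOf C).IsTriangulated where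
  exists_zero := by
    have h0 (n : ℤ) : IsZero ((0 : CochainComplex 𝒜 ℤ).X n) :=
      (HomologicalComplex.eval 𝒜 (ComplexShape.up ℤ) n).map_isZero (isZero_zero _)
    exact ⟨(HomotopyCategory.quotient _ _).obj 0, Functor.map_isZero _ (isZero_zero _),
      ⟨0, 0, fun n _ => h0 n⟩, fun n => C.prop_of_isTerminal _ (h0 n).isTerminal⟩
  toIsStableUnderShift := boundedOf_isStableUnderShift C
  toIsTriangulatedClosed₂ := by
    have : (boundedOf C).IsTriangulatedClosed₃ := ⟨fun T hT => by
      rintro ⟨⟨a, b, h⟩, h₁⟩ ⟨⟨a', b', h'⟩, h₂⟩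
      obtain ⟨f, ⟨e⟩⟩ := exists_iso_mappingCone T hT
      refine ⟨_, ⟨⟨min (a - 1) a', max b b', fun n hn => ?_⟩, ?_⟩, ⟨e⟩⟩
      · exact isZero_mappingCone f (h _ (by omega)) (h' _ (by omega))
      · exact prop_mappingCone C f h₁ h₂⟩
    have := boundedOf_isStableUnderShift C
    exact .of_isTriangulatedClosed₃

instance : (KbOf C).IsTriangulated := by
  unfold KbOf
  infer_instance

instance : ((KbOf C).ι ⋙ Qb C).Full where
  map_surjective {X Y} g := by
    obtain ⟨φ, hφ⟩ := Localization.exists_rightFraction (Qb C) (acyclic C).trW g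
    obtain ⟨N, a, b, hT, hN⟩ := (acyclic C).trW_iff φ.s |>.1 φ.hs
    obtain ⟨t, ht⟩ : ∃ t : X.obj ⟶ φ.X', 𝟙 X.obj = t ≫ φ.s :=
      Triangle.coyoneda_exact₂ _ hT (𝟙 X.obj) (eq_zero_of_acyclic C X.property hN _)
    refine ⟨(KbOf C).homMk (t ≫ φ.f), ?_⟩
    have := Localization.inverts (Qb C) (acyclic C).trW φ.s φ.hs
    rw [hφ, ← cancel_epi ((Qb C).map φ.s), MorphismProperty.RightFraction.map_s_comp_map]
    have h2 : (Qb C).map φ.s ≫ (Qb C).map t = 𝟙 _ := by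
      rw [← cancel_mono ((Qb C).map φ.s), Category.assoc, ← Functor.map_comp]
      rw [← ht]
      simp
    change (Qb C).map φ.s ≫ (Qb C).map (t ≫ φ.f) = _
    rw [Functor.map_comp, reassoc_of% h2]

/-- `K^b(C)` viewed as a full subcategory of `D^b_C(𝒜)`: the objects isomorphic to the image
of a bounded complex of objects of `C`. -/
def KbOfInDbC : ObjectProperty (DbC C) := (KbOf C).map (Qb C)

instance : (KbOfInDbC C).IsTriangulated := by
  unfold KbOfInDbC
  rw [← Functor.essImage_ι_comp]
  infer_instance

/-- The `C`-singularity category: the Verdier quotient `D^b_C(𝒜) / K^b(C)`. -/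
abbrev Dsg := (KbOfInDbC C).trW.Localization

/-- The localization functor `D^b_C(𝒜) ⥤ D_{C-sg}(𝒜)`. -/
abbrev Qsg : DbC C ⥤ Dsg C := (KbOfInDbC C).trW.Q

instance (n : ℤ) : (shiftFunctor (Dsg C) n).Additive :=
  Triangulated.Localization.instAdditiveLocalizationShiftFunctorInt (KbOfInDbC C).trW n


variable (𝒜) in
/-- The functor `𝒜 ⥤ K^b(𝒜)` sending an object to the complex concentrated in degree `0`. -/
def toKb : 𝒜 ⥤ Kb 𝒜 :=
  (bounded 𝒜).lift (HomotopyCategory.singleFunctor 𝒜 0) (fun X => ⟨0, 0, fun n hn =>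
    HomologicalComplex.isZero_single_obj_X (ComplexShape.up ℤ) 0 X n (by omega)⟩)

instance : (toKb 𝒜).Additive := by
  constructor
  intro X Y f g
  apply ObjectProperty.hom_ext
  exact (HomotopyCategory.singleFunctor 𝒜 0).map_add

/-- The functor `𝒜 ⥤ D^b_C(𝒜) ⥤ D_{C-sg}(𝒜)`. -/
def toDsg : 𝒜 ⥤ Dsg C := toKb 𝒜 ⋙ Qb C ⋙ Qsg C

instance : (toDsg C).Additive := by
  unfold toDsg
  infer_instance

lemma isZero_toDsg {X : 𝒜} (hX : C X) : IsZero ((toDsg C).obj X) := by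
  have h : KbOf C ((toKb 𝒜).obj X) := by
    refine ObjectProperty.le_isoClosure _ _ ⟨((toKb 𝒜).obj X).property, fun n => ?_⟩
    have := ObjectProperty.IsClosedUnderBinaryProducts.closedUnderIsomorphisms C
    by_cases hn : n = 0
    · subst hn
      exact C.prop_of_iso
        (HomologicalComplex.singleObjXSelf (ComplexShape.up ℤ) 0 X).symm hX
    · exact C.prop_of_isTerminal _
        (HomologicalComplex.isZero_single_obj_X _ 0 X n hn).isTerminal
  have h' : KbOfInDbC C ((Qb C).obj ((toKb 𝒜).obj X)) :=
    ObjectProperty.prop_map_obj _ _ h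
  have hW : (KbOfInDbC C).trW (0 : 0 ⟶ (Qb C).obj ((toKb 𝒜).obj X)) :=
    ObjectProperty.trW.mk _ (contractible_distinguished₁ _) h'
  have := Localization.inverts (Qsg C) (KbOfInDbC C).trW _ hW
  exact IsZero.of_iso ((Qsg C).map_isZero (isZero_zero _))
    (asIso ((Qsg C).map (0 : 0 ⟶ (Qb C).obj ((toKb 𝒜).obj X)))).symm

end

/-! ### The Gorenstein category and its conflations -/

/-- The Gorenstein category `𝒢(C)`: the objects isomorphic to the image of `K⁻¹ ⟶ K⁰` for an
acyclic complex `K` of objects of `C` that is `Hom(C, -)`-exact and `Hom(-, C)`-exact. -/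
def gorenstein : ObjectProperty 𝒜 := fun M =>
  ∃ K : CochainComplex 𝒜 ℤ, (∀ n, C (K.X n)) ∧ K.Acyclic ∧ HomFromExact C K ∧ HomToExact C K ∧
    Nonempty (M ≅ image (K.d (-1) 0))

/-- The Gorenstein category as a category. -/
abbrev Gor := (gorenstein C).FullSubcategory

/-- The class `ε` of conflations of `𝒢(C)`: the complexes `0 ⟶ L ⟶ M ⟶ N ⟶ 0` with terms in
`𝒢(C)` such that `0 ⟶ Hom(X, L) ⟶ Hom(X, M) ⟶ Hom(X, N) ⟶ 0` is exact for all `X` in `C`. -/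
def IsConflation (S : ShortComplex (Gor C)) : Prop :=
  ∀ ⦃X : 𝒜⦄, C X →
    (S.map ((gorenstein C).ι ⋙ preadditiveCoyoneda.obj (op X))).ShortExact

/-- The complex `K` moved one step to the left, with unchanged differentials. -/
def moveLeft (K : CochainComplex 𝒜 ℤ) : CochainComplex 𝒜 ℤ where
  X n := K.X (n + 1)
  d i j := K.d (i + 1) (j + 1)
  shape i j h := K.shape _ _ (fun h' => h (by simp at h' ⊢; omega))

/-- A conflation `0 ⟶ M ⟶ I ⟶ M' ⟶ 0` with `I` in `C` and `M'` in `𝒢(C)`, such that every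
morphism from `M` to an object of `C` extends to `I`. -/
structure Cosyzygy (M : Gor C) where
  I : 𝒜
  cosyz : Gor C
  i : M.obj ⟶ I
  p : I ⟶ cosyz.obj
  prop_I : C I
  zero : i ≫ p = 0
  shortExact : (ShortComplex.mk i p zero).ShortExact
  lift ⦃X : 𝒜⦄ (_ : C X) (f : X ⟶ cosyz.obj) : ∃ g : X ⟶ I, g ≫ p = f
  extend ⦃X : 𝒜⦄ (_ : C X) (f : M.obj ⟶ X) : ∃ g : I ⟶ X, i ≫ g = f

instance (M : Gor C) : Nonempty (Cosyzygy C M) := by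
  obtain ⟨M, K, hK, hac, h₁, h₂, ⟨e⟩⟩ := M
  have hex (i j k : ℤ) (hij : i + 1 = j) (hjk : j + 1 = k) : (K.sc' i j k).Exact :=
    (HomologicalComplex.exactAt_iff' _ i j k (ComplexShape.prev_eq' _ hij)
      (ComplexShape.next_eq' _ hjk)).1 (hac j)
  have hG : gorenstein C (image (K.d 0 1)) := by
    refine ⟨moveLeft K, fun n => hK _, fun n => ?_, ?_, ?_, ⟨Iso.refl _⟩⟩
    · rw [HomologicalComplex.exactAt_iff' _ (n - 1) n (n + 1) (by simp) (by simp)]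
      exact hex (n - 1 + 1) (n + 1) (n + 1 + 1) (by omega) rfl
    · exact homFromExact_of_exists_lift fun X hX j f hf =>
        h₁.exists_lift hX (i := j - 1 + 1) (k := j + 1 + 1) (by omega) rfl f hf
    · exact homToExact_of_exists_desc fun X hX j f hf =>
        h₂.exists_desc hX (i := j - 1 + 1) (k := j + 1 + 1) (by omega) rfl f hf
  have hz : (e.hom ≫ image.ι (K.d (-1) 0)) ≫ factorThruImage (K.d 0 1) = 0 := by
    rw [← cancel_mono (image.ι (K.d 0 1)), ← cancel_epi e.inv,
      ← cancel_epi (factorThruImage (K.d (-1) 0))]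
    simp
  refine ⟨{ I := K.X 0, cosyz := ⟨_, hG⟩, i := e.hom ≫ image.ι (K.d (-1) 0)
            p := factorThruImage (K.d 0 1), prop_I := hK 0, zero := hz
            shortExact := ?_, lift := ?_, extend := ?_ }⟩
  · have : Mono (e.hom ≫ image.ι (K.d (-1) 0)) := inferInstance
    have : Epi (factorThruImage (K.d 0 1)) := inferInstance
    refine { exact := ?_, mono_f := ‹_›, epi_g := ‹_› }
    rw [ShortComplex.exact_iff_exact_up_to_refinements]
    intro A x hx
    have hx' : x ≫ K.d 0 1 = 0 := by
      have := congrArg (· ≫ image.ι (K.d 0 1)) hx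
      simpa using this
    obtain ⟨A', π, hπ, y, hy⟩ := (ShortComplex.exact_iff_exact_up_to_refinements _).1
      (hex (-1) 0 1 (by norm_num) (by norm_num)) x hx'
    refine ⟨A', π, hπ, y ≫ factorThruImage (K.d (-1) 0) ≫ e.inv, ?_⟩
    have hfac : (factorThruImage (K.d (-1) 0) ≫ e.inv) ≫ e.hom ≫ image.ι (K.d (-1) 0) =
        K.d (-1) 0 := by simp
    exact hy.trans ((congrArg (y ≫ ·) hfac.symm).trans (Category.assoc _ _ _).symm)
  · intro X hX f
    obtain ⟨g, hg⟩ := h₁.exists_lift hX (i := 0) (j := 1) (k := 2) (by norm_num) (by norm_num)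
      (f ≫ image.ι (K.d 0 1)) (by
        have : image.ι (K.d 0 1) ≫ K.d 1 2 = 0 := by
          rw [← cancel_epi (factorThruImage (K.d 0 1))]; simp
        rw [Category.assoc, this, comp_zero])
    exact ⟨g, by rw [← cancel_mono (image.ι (K.d 0 1))]; simpa using hg⟩
  · intro X hX f
    obtain ⟨g, hg⟩ := h₂.exists_desc hX (i := -2) (j := -1) (k := 0) (by norm_num) (by norm_num)
      (factorThruImage (K.d (-1) 0) ≫ e.inv ≫ f) (by
        have : K.d (-2) (-1) ≫ factorThruImage (K.d (-1) 0) = 0 := by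
          rw [← cancel_mono (image.ι (K.d (-1) 0))]; simp
        rw [reassoc_of% this, zero_comp])
    refine ⟨g, ?_⟩
    rw [← cancel_epi e.inv, ← cancel_epi (factorThruImage (K.d (-1) 0))]
    simpa using hg

/-- For each `M` in `𝒢(C)`, a chosen conflation `0 ⟶ M ⟶ I(M) ⟶ S(M) ⟶ 0`. -/
def cosyzygy (M : Gor C) : Cosyzygy C M := Classical.arbitrary _

/-! ### The stable category -/

/-- The morphism `f` of `𝒢(C)` factors through an object of `C`. -/
def FactorsThrough {M N : Gor C} (f : M ⟶ N) : Prop :=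
  ∃ (X : 𝒜) (_ : C X) (a : M.obj ⟶ X) (b : X ⟶ N.obj), a ≫ b = f.hom

/-- Two morphisms of `𝒢(C)` are identified in the stable category when their difference factors
through an object of `C`. -/
def stableRel : HomRel (Gor C) := fun _ _ f g => FactorsThrough C (f - g)

/-- The stable category of `𝒢(C)`. -/
abbrev Stable := CategoryTheory.Quotient (stableRel C)

/-- The projection functor to the stable category. -/
abbrev toStable : Gor C ⥤ Stable C := CategoryTheory.Quotient.functor (stableRel C)

variable {C} in
lemma FactorsThrough.add [C.IsClosedUnderFiniteProducts] {M N : Gor C} {f g : M ⟶ N} (hf : FactorsThrough C f)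
    (hg : FactorsThrough C g) : FactorsThrough C (f + g) := by
  obtain ⟨X, hX, a, b, h⟩ := hf
  obtain ⟨X', hX', a', b', h'⟩ := hg
  have := ObjectProperty.IsClosedUnderBinaryProducts.closedUnderIsomorphisms C
  refine ⟨X ⊞ X', C.prop_of_iso (biprod.isoProd _ _).symm (C.prop_prod _ _ hX hX'),
    biprod.lift a a', biprod.desc b b', ?_⟩
  rw [biprod.lift_desc, h, h']
  rfl

variable {C} in
lemma FactorsThrough.neg {M N : Gor C} {f : M ⟶ N} (hf : FactorsThrough C f) :
    FactorsThrough C (-f) := by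
  obtain ⟨X, hX, a, b, h⟩ := hf
  exact ⟨X, hX, -a, b, by rw [Preadditive.neg_comp, h]; rfl⟩

instance [C.IsClosedUnderFiniteProducts] : Congruence (stableRel C) where
  equivalence := {
    refl := fun f => by
      refine ⟨0, C.prop_of_isTerminal _ (isZero_zero 𝒜).isTerminal, 0, 0, ?_⟩
      rw [sub_self, comp_zero]
      rfl
    symm := fun {f g} h => by
      have := FactorsThrough.neg h
      rwa [neg_sub] at this
    trans := fun {f g k} h h' => by
      have := FactorsThrough.add h h'
      rwa [sub_add_sub_cancel] at this }
  comp_left := by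
    rintro M N P f g g' ⟨X, hX, a, b, h⟩
    refine ⟨X, hX, f.hom ≫ a, b, ?_⟩
    rw [Category.assoc, h, ← Preadditive.comp_sub]
    rfl
  comp_right := by
    rintro M N P f f' g ⟨X, hX, a, b, h⟩
    refine ⟨X, hX, a, b ≫ g.hom, ?_⟩
    rw [← Category.assoc, h, ← Preadditive.sub_comp]
    rfl

lemma stableRel_add [C.IsClosedUnderFiniteProducts] ⦃M N : Gor C⦄
    (f₁ f₂ g₁ g₂ : M ⟶ N) (hf : stableRel C f₁ f₂)
    (hg : stableRel C g₁ g₂) : stableRel C (f₁ + g₁) (f₂ + g₂) := by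
  have := FactorsThrough.add hf hg
  rwa [sub_add_sub_comm] at this

instance [C.IsClosedUnderFiniteProducts] : Preadditive (Stable C) :=
  CategoryTheory.Quotient.preadditive _ (stableRel_add C)

instance [C.IsClosedUnderFiniteProducts] : (toStable C).Additive :=
  CategoryTheory.Quotient.functor_additive _ (stableRel_add C)

/-! ### The suspension functor of the stable category -/

lemma exists_cosyzygyMap {M N : Gor C} (f : M ⟶ N) :
    ∃ (a : (cosyzygy C M).I ⟶ (cosyzygy C N).I)
      (b : (cosyzygy C M).cosyz ⟶ (cosyzygy C N).cosyz),
      (cosyzygy C M).i ≫ a = f.hom ≫ (cosyzygy C N).i ∧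
      (cosyzygy C M).p ≫ b.hom = a ≫ (cosyzygy C N).p := by
  obtain ⟨a, ha⟩ := (cosyzygy C M).extend (cosyzygy C N).prop_I (f.hom ≫ (cosyzygy C N).i)
  have hS := (cosyzygy C M).shortExact
  have := hS.epi_g
  have h0 : (cosyzygy C M).i ≫ a ≫ (cosyzygy C N).p = 0 := by
    rw [reassoc_of% ha, (cosyzygy C N).zero, comp_zero]
  exact ⟨a, ⟨hS.exact.desc _ h0⟩, ha, hS.exact.g_desc _ h0⟩

/-- The morphism `S(M) ⟶ S(N)` induced by an extension of `f` to a morphism `I(M) ⟶ I(N)`. -/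
def cosyzygyMap {M N : Gor C} (f : M ⟶ N) :
    (cosyzygy C M).cosyz ⟶ (cosyzygy C N).cosyz :=
  (exists_cosyzygyMap C f).choose_spec.choose

lemma cosyzygyMap_spec {M N : Gor C} (f : M ⟶ N) :
    ∃ a : (cosyzygy C M).I ⟶ (cosyzygy C N).I,
      (cosyzygy C M).i ≫ a = f.hom ≫ (cosyzygy C N).i ∧
      (cosyzygy C M).p ≫ (cosyzygyMap C f).hom = a ≫ (cosyzygy C N).p :=
  ⟨_, (exists_cosyzygyMap C f).choose_spec.choose_spec⟩

/-- A morphism of chosen conflations whose first component factors through `C` has a third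
component that factors through `C`. -/
lemma factorsThrough_cosyz {M N : Gor C} {f : M ⟶ N} (hf : FactorsThrough C f)
    (a : (cosyzygy C M).I ⟶ (cosyzygy C N).I)
    (b : (cosyzygy C M).cosyz ⟶ (cosyzygy C N).cosyz)
    (ha : (cosyzygy C M).i ≫ a = f.hom ≫ (cosyzygy C N).i)
    (hb : (cosyzygy C M).p ≫ b.hom = a ≫ (cosyzygy C N).p) : FactorsThrough C b := by
  obtain ⟨X, hX, x, y, hxy⟩ := hf
  obtain ⟨z, hz⟩ := (cosyzygy C M).extend hX x
  have hS := (cosyzygy C M).shortExact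
  have := hS.epi_g
  have h0 : (cosyzygy C M).i ≫ (a - z ≫ y ≫ (cosyzygy C N).i) = 0 := by
    rw [Preadditive.comp_sub, ha, reassoc_of% hz, reassoc_of% hxy, sub_self]
  refine ⟨_, (cosyzygy C N).prop_I, hS.exact.desc _ h0, (cosyzygy C N).p, ?_⟩
  rw [← cancel_epi (cosyzygy C M).p, hb]
  have h1 : (cosyzygy C M).p ≫ hS.exact.desc _ h0 = a - z ≫ y ≫ (cosyzygy C N).i :=
    hS.exact.g_desc _ h0
  rw [reassoc_of% h1, Preadditive.sub_comp, Category.assoc, Category.assoc,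
    (cosyzygy C N).zero, comp_zero, comp_zero, sub_zero]

lemma stableRel_cosyzygyMap {M N : Gor C} {f g : M ⟶ N} (h : stableRel C f g)
    (a : (cosyzygy C M).I ⟶ (cosyzygy C N).I)
    (b : (cosyzygy C M).cosyz ⟶ (cosyzygy C N).cosyz)
    (ha : (cosyzygy C M).i ≫ a = g.hom ≫ (cosyzygy C N).i)
    (hb : (cosyzygy C M).p ≫ b.hom = a ≫ (cosyzygy C N).p) :
    stableRel C (cosyzygyMap C f) b := by
  obtain ⟨a', ha', hb'⟩ := cosyzygyMap_spec C f
  refine factorsThrough_cosyz C h (a' - a) _ ?_ ?_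
  · rw [Preadditive.comp_sub, ha, ha', ← Preadditive.sub_comp]
    rfl
  · rw [Preadditive.sub_comp, ← hb, ← hb', ← Preadditive.comp_sub]
    rfl

lemma stableRel_refl [C.IsClosedUnderFiniteProducts] {M N : Gor C} (f : M ⟶ N) : stableRel C f f :=
  (Congruence.equivalence (r := stableRel C)).refl f

/-- The suspension functor of the stable category: it is `M ↦ S(M)` on objects. -/
def suspension [C.IsClosedUnderFiniteProducts] : Stable C ⥤ Stable C :=
  CategoryTheory.Quotient.lift (stableRel C)
    { obj := fun M => (toStable C).obj (cosyzygy C M).cosyz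
      map := fun f => (toStable C).map (cosyzygyMap C f)
      map_id := fun M => by
        rw [← (toStable C).map_id]
        exact CategoryTheory.Quotient.sound _ (stableRel_cosyzygyMap C (stableRel_refl C _)
          (𝟙 _) (𝟙 _) ((Category.comp_id _).trans (Category.id_comp _).symm)
          ((Category.comp_id _).trans (Category.id_comp _).symm))
      map_comp := fun {M N P} f g => by
        rw [← (toStable C).map_comp]
        obtain ⟨a, ha, hb⟩ := cosyzygyMap_spec C f
        obtain ⟨a', ha', hb'⟩ := cosyzygyMap_spec C g
        refine CategoryTheory.Quotient.sound _ (stableRel_cosyzygyMap C (stableRel_refl C _)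
          (a ≫ a') _ ?_ ?_)
        · rw [reassoc_of% ha, ha']
          exact (Category.assoc _ _ _).symm
        · rw [Category.assoc, ← hb', ← Category.assoc, ← hb, Category.assoc]
          rfl }
    (fun M N f g h => by
      obtain ⟨a, ha, hb⟩ := cosyzygyMap_spec C g
      exact CategoryTheory.Quotient.sound _ (stableRel_cosyzygyMap C h a _ ha hb))

section

variable [C.IsClosedUnderFiniteProducts]

/-! ### Distinguished triangles of the stable category -/

/-- The standard triangle `X ⟶ Y ⟶ Z ⟶ S(X)` of a morphism `u : X ⟶ Y` of `𝒢(C)`: here `Z` is the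
pushout of the chosen inflation `X ⟶ I(X)` along `u` (pushouts of inflations of `𝒢(C)` are computed
in `𝒜`), and `w` is induced by `I(X) ⟶ S(X)` and
`0 : Y ⟶ S(X)`. -/
def IsStandard {X Y Z : Gor C} (u : X ⟶ Y) (v : Y ⟶ Z) (w : Z ⟶ (cosyzygy C X).cosyz) : Prop :=
  ∃ t : (cosyzygy C X).I ⟶ Z.obj, IsPushout (cosyzygy C X).i u.hom t v.hom ∧
    t ≫ w.hom = (cosyzygy C X).p ∧ v ≫ w = 0

/-- The distinguished triangles of the stable category: the sextuples isomorphic to the image of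
a standard triangle. -/
def IsDistinguished {X Y Z : Stable C} (u : X ⟶ Y) (v : Y ⟶ Z) (w : Z ⟶ (suspension C).obj X) :
    Prop :=
  ∃ (X' Y' Z' : Gor C) (u' : X' ⟶ Y') (v' : Y' ⟶ Z') (w' : Z' ⟶ (cosyzygy C X').cosyz)
    (_ : IsStandard C u' v' w')
    (a : X ≅ (toStable C).obj X') (b : Y ≅ (toStable C).obj Y') (c : Z ≅ (toStable C).obj Z'),
    u ≫ b.hom = a.hom ≫ (toStable C).map u' ∧
    v ≫ c.hom = b.hom ≫ (toStable C).map v' ∧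
    w ≫ (suspension C).map a.hom = c.hom ≫ (toStable C).map w'

/-! ### The functors to the `C`-singularity category -/

/-- The functor `θ : 𝒢(C) ⥤ D_{C-sg}(𝒜)`. -/
def theta : Gor C ⥤ Dsg C := (gorenstein C).ι ⋙ toDsg C

/-- The functor `θ'` induced by `θ` on the stable category. -/
def thetaStable : Stable C ⥤ Dsg C :=
  CategoryTheory.Quotient.lift (stableRel C) (theta C) (fun M N f g h => by
    obtain ⟨X, hX, a, b, hab⟩ := h
    have h1 : (toDsg C).map (f.hom - g.hom) = 0 := by
      have h2 : f.hom - g.hom = a ≫ b := hab.symm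
      rw [h2, Functor.map_comp, (isZero_toDsg C hX).eq_of_src ((toDsg C).map b) 0, comp_zero]
    rw [Functor.map_sub, sub_eq_zero] at h1
    exact h1)

variable {T : Type*} [Category T] [HasZeroObject T] [HasShift T ℤ] [Preadditive T]
  [∀ n : ℤ, (shiftFunctor T n).Additive] [Pretriangulated T]

/-- `F : 𝒢(C) ⥤ T` is a `∂`-functor: it is additive and there are connecting morphisms
`ω_S : F(N) ⟶ F(L)[1]`, for all conflations `S : L ⟶ M ⟶ N`, which are functorial in `S` and turn
the image of `S` into a distinguished triangle. -/
def IsDeltaFunctor (F : Gor C ⥤ T) : Prop :=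
  F.Additive ∧
  ∃ ω : ∀ S : ShortComplex (Gor C), IsConflation C S → (F.obj S.X₃ ⟶ (F.obj S.X₁)⟦(1 : ℤ)⟧),
    (∀ (S : ShortComplex (Gor C)) (hS : IsConflation C S),
      Triangle.mk (F.map S.f) (F.map S.g) (ω S hS) ∈ distTriang T) ∧
    ∀ (S S' : ShortComplex (Gor C)) (hS : IsConflation C S) (hS' : IsConflation C S')
      (φ : S ⟶ S'), ω S hS ≫ (F.map φ.τ₁)⟦(1 : ℤ)⟧' = F.map φ.τ₃ ≫ ω S' hS'

/-- `F` is a triangle functor from the stable category of `𝒢(C)` to `T`: it is additive and there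
is a natural isomorphism `F ∘ S ≅ [1] ∘ F` through which `F` sends distinguished triangles to
distinguished triangles. -/
def IsTriangleFunctor (F : Stable C ⥤ T) : Prop :=
  F.Additive ∧
  ∃ ω : suspension C ⋙ F ≅ F ⋙ shiftFunctor T (1 : ℤ),
    ∀ ⦃X Y Z : Stable C⦄ (u : X ⟶ Y) (v : Y ⟶ Z) (w : Z ⟶ (suspension C).obj X),
      IsDistinguished C u v w →
        Triangle.mk (F.map u) (F.map v) (F.map w ≫ ω.hom.app X) ∈ distTriang T

end

end RelSing

end

noncomputable section

namespace RelSing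

variable {𝒜 : Type u} [Category.{v} 𝒜] [Abelian 𝒜] (C : ObjectProperty 𝒜)

/-- A short complex `S` is `Hom(C, -)`-exact if `0 ⟶ Hom(X, S.X₁) ⟶ Hom(X, S.X₂) ⟶ Hom(X, S.X₃) ⟶ 0`
is exact for all `X` in `C`. -/
def HomFromShortExact (S : ShortComplex 𝒜) : Prop :=
  ∀ ⦃X : 𝒜⦄, C X → (S.map (preadditiveCoyoneda.obj (op X))).ShortExact

variable {C} in
/-- A short exact sequence is `Hom(C, -)`-exact when morphisms from `C` lift along its
epimorphism. -/
lemma homFromShortExact_of_exists_lift {S : ShortComplex 𝒜} (hS : S.ShortExact)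
    (h : ∀ ⦃X : 𝒜⦄, C X → ∀ f : X ⟶ S.X₃, ∃ g : X ⟶ S.X₂, g ≫ S.g = f) :
    HomFromShortExact C S := by
  intro X hX
  have := hS.mono_f
  refine { exact := ?_, mono_f := ?_, epi_g := ?_ }
  · rw [ShortComplex.ab_exact_iff]
    exact fun (f : X ⟶ S.X₂) hf => ⟨hS.exact.lift f hf, hS.exact.lift_f f hf⟩
  · rw [AddCommGrpCat.mono_iff_injective]
    exact fun (f g : X ⟶ S.X₁) hfg => (cancel_mono S.f).1 hfg
  · rw [AddCommGrpCat.epi_iff_surjective]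
    exact fun f => h hX f

/-! ### The mapping cone triangle of a short complex in `K^b(𝒜)` -/

/-- A short complex of objects viewed as a short complex of complexes concentrated in
degree `0`. -/
abbrev singleShortComplex (S : ShortComplex 𝒜) : ShortComplex (CochainComplex 𝒜 ℤ) :=
  S.map (CochainComplex.singleFunctor 𝒜 0)

lemma bounded_mappingCone_single {X Y : 𝒜} (f : X ⟶ Y) :
    bounded 𝒜 ((HomotopyCategory.quotient _ _).obj
      (CochainComplex.mappingCone ((CochainComplex.singleFunctor 𝒜 0).map f))) := by
  refine ⟨-1, 0, fun n hn => isZero_mappingCone _ ?_ ?_⟩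
  · exact HomologicalComplex.isZero_single_obj_X (ComplexShape.up ℤ) 0 X (n + 1) (by omega)
  · exact HomologicalComplex.isZero_single_obj_X (ComplexShape.up ℤ) 0 Y n (by omega)

/-- The mapping cone of a morphism of `𝒜`, as an object of `K^b(𝒜)`. -/
def coneKb {X Y : 𝒜} (f : X ⟶ Y) : Kb 𝒜 := ⟨_, bounded_mappingCone_single f⟩

/-- The mapping cone triangle of a morphism of `𝒜` in `K^b(𝒜)`. -/
def coneTriangle {X Y : 𝒜} (f : X ⟶ Y) : Triangle (Kb 𝒜) :=
  Triangle.mk ((toKb 𝒜).map f)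
    ((bounded 𝒜).homMk (CochainComplex.mappingCone.triangleh
      ((CochainComplex.singleFunctor 𝒜 0).map f)).mor₂ : (toKb 𝒜).obj Y ⟶ coneKb f)
    ((bounded 𝒜).homMk ((CochainComplex.mappingCone.triangleh
      ((CochainComplex.singleFunctor 𝒜 0).map f)).mor₃ ≫
        ((bounded 𝒜).ι.commShiftIso (1 : ℤ)).inv.app ((toKb 𝒜).obj X)))

lemma coneTriangle_distinguished {X Y : 𝒜} (f : X ⟶ Y) : coneTriangle f ∈ distTriang (Kb 𝒜) := by
  refine isomorphic_distinguished _ (HomotopyCategory.mappingCone_triangleh_distinguished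
    ((CochainComplex.singleFunctor 𝒜 0).map f)) _
      (Triangle.isoMk _ _ (Iso.refl _) (Iso.refl _) (Iso.refl _) ?_ ?_ ?_)
  · exact (Category.comp_id _).trans (Category.id_comp _).symm
  · exact (Category.comp_id _).trans (Category.id_comp _).symm
  · have h : (shiftFunctor (HomotopyCategory 𝒜 (ComplexShape.up ℤ)) (1 : ℤ)).map
        (𝟙 ((HomotopyCategory.singleFunctor 𝒜 0).obj X)) = 𝟙 _ :=
      CategoryTheory.Functor.map_id _ _
    refine (congrArg (_ ≫ ·) h).trans ?_
    refine (Category.comp_id _).trans (Eq.trans ?_ (Category.id_comp _).symm)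
    change (_ ≫ ((bounded 𝒜).ι.commShiftIso (1 : ℤ)).inv.app ((toKb 𝒜).obj X)) ≫
      ((bounded 𝒜).ι.commShiftIso (1 : ℤ)).hom.app ((toKb 𝒜).obj X) = _
    refine (Category.assoc _ _ _).trans ?_
    exact (congrArg (_ ≫ ·) (Iso.inv_hom_id_app
      ((bounded 𝒜).ι.commShiftIso (1 : ℤ)) ((toKb 𝒜).obj X))).trans (Category.comp_id _)

/-- The morphism from the mapping cone of `S.f` to `S.X₃` in `K^b(𝒜)`. -/
def coneDesc (S : ShortComplex 𝒜) : coneKb S.f ⟶ (toKb 𝒜).obj S.X₃ :=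
  (bounded 𝒜).homMk ((HomotopyCategory.quotient _ _).map
    (CochainComplex.mappingCone.descShortComplex (singleShortComplex S)))

lemma coneTriangle_mor₂_coneDesc (S : ShortComplex 𝒜) :
    (coneTriangle S.f).mor₂ ≫ coneDesc S = (toKb 𝒜).map S.g := by
  apply ObjectProperty.hom_ext
  change (HomotopyCategory.quotient _ _).map _ ≫ (HomotopyCategory.quotient _ _).map _ =
    (HomotopyCategory.quotient _ _).map _
  refine (Functor.map_comp _ _ _).symm.trans ?_
  exact congrArg _ (CochainComplex.mappingCone.inr_descShortComplex (singleShortComplex S))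

/-- The morphism on mapping cones induced by a morphism of short complexes. -/
def coneMap {S S' : ShortComplex 𝒜} (φ : S ⟶ S') : coneKb S.f ⟶ coneKb S'.f :=
  (bounded 𝒜).homMk ((HomotopyCategory.quotient _ _).map
    (CochainComplex.mappingCone.map (singleShortComplex S).f (singleShortComplex S').f
      _ _ ((CochainComplex.singleFunctor 𝒜 0).mapShortComplex.map φ).comm₁₂.symm))

lemma coneMap_coneDesc {S S' : ShortComplex 𝒜} (φ : S ⟶ S') :
    coneMap φ ≫ coneDesc S' = coneDesc S ≫ (toKb 𝒜).map φ.τ₃ := by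
  apply ObjectProperty.hom_ext
  change (HomotopyCategory.quotient _ _).map _ ≫ (HomotopyCategory.quotient _ _).map _ =
    (HomotopyCategory.quotient _ _).map _ ≫ (HomotopyCategory.quotient _ _).map _
  refine (Functor.map_comp _ _ _).symm.trans (Eq.trans ?_ (Functor.map_comp _ _ _))
  exact congrArg _ (CochainComplex.mappingCone.descShortComplex_naturality
    ((CochainComplex.singleFunctor 𝒜 0).mapShortComplex.map φ))

lemma coneMap_mor₃ {S S' : ShortComplex 𝒜} (φ : S ⟶ S') :
    coneMap φ ≫ (coneTriangle S'.f).mor₃ =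
      (coneTriangle S.f).mor₃ ≫ ((toKb 𝒜).map φ.τ₁)⟦(1 : ℤ)⟧' := by
  apply ObjectProperty.hom_ext
  let ψ := (HomotopyCategory.quotient 𝒜 (ComplexShape.up ℤ)).mapTriangle.map
    (CochainComplex.mappingCone.triangleMap _ _ _ _
      ((CochainComplex.singleFunctor 𝒜 0).mapShortComplex.map φ).comm₁₂.symm)
  have h := ψ.comm₃
  have h' := ((bounded 𝒜).ι.commShiftIso (1 : ℤ)).inv.naturality ((toKb 𝒜).map φ.τ₁)
  change ψ.hom₃ ≫ _ ≫ ((bounded 𝒜).ι.commShiftIso (1 : ℤ)).inv.app _ =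
    (_ ≫ ((bounded 𝒜).ι.commShiftIso (1 : ℤ)).inv.app _) ≫
      (bounded 𝒜).ι.map (((toKb 𝒜).map φ.τ₁)⟦(1 : ℤ)⟧')
  refine (Category.assoc _ _ _).symm.trans ?_
  refine (congrArg (· ≫ _) h.symm).trans ?_
  refine (Category.assoc _ _ _).trans ((congrArg (_ ≫ ·) h').trans (Category.assoc _ _ _).symm)

/-- The mapping cone of the first morphism of a `Hom(C, -)`-exact short complex is isomorphic to
the third object in `D^b_C(𝒜)`. -/
lemma trW_coneDesc {S : ShortComplex 𝒜} (hS : HomFromShortExact C S) :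
    (acyclic C).trW (coneDesc S) := by
  obtain ⟨Z, g, h, hT⟩ := distinguished_cocone_triangle (coneDesc S)
  refine ((acyclic C).trW_iff_of_distinguished _ hT).2 ?_
  change acyclic C Z
  rw [acyclic_iff]
  intro X hX
  refine (((HomotopyCategory.subcategoryAcyclic AddCommGrpCat.{v}).inverseImage
      ((bounded 𝒜).ι ⋙ (preadditiveCoyoneda.obj (op X)).mapHomotopyCategory
        (ComplexShape.up ℤ))).trW_iff_of_distinguished _ hT).1 ?_
  rw [ObjectProperty.inverseImage_trW_iff,
    ← HomotopyCategory.quasiIso_eq_trW_subcategoryAcyclic]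
  let F := preadditiveCoyoneda.obj (op X)
  change HomotopyCategory.quasiIso _ _ ((HomotopyCategory.quotient _ _).map
    ((F.mapHomologicalComplex (ComplexShape.up ℤ)).map
      (CochainComplex.mappingCone.descShortComplex (singleShortComplex S))))
  rw [HomotopyCategory.quotient_map_mem_quasiIso_iff, HomologicalComplex.mem_quasiIso_iff,
    ← CochainComplex.mappingCone.mapHomologicalComplexIso_hom_descShortComplex]
  have hS' : ((singleShortComplex S).map
      (F.mapHomologicalComplex (ComplexShape.up ℤ))).ShortExact := by
    refine ShortComplex.shortExact_of_iso ?_ ((hS hX).map_of_exact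
      (HomologicalComplex.single AddCommGrpCat (ComplexShape.up ℤ) 0))
    exact ShortComplex.mapNatIso S
      (HomologicalComplex.singleMapHomologicalComplex F (ComplexShape.up ℤ) 0).symm
  exact @quasiIso_comp _ _ _ _ _ _ _ _ _ _ _ _ _ inferInstance
    (CochainComplex.mappingCone.quasiIso_descShortComplex hS')

section

variable [C.IsClosedUnderFiniteProducts]

/-! ### The connecting morphism in the `C`-singularity category -/

/-- The functor `K^b(𝒜) ⥤ D_{C-sg}(𝒜)`. -/
abbrev kbToDsg : Kb 𝒜 ⥤ Dsg C := Qb C ⋙ Qsg C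

/-- In `D_{C-sg}(𝒜)`, the mapping cone of the first morphism of a `Hom(C, -)`-exact short complex
is isomorphic to the third object. -/
def coneIso {S : ShortComplex 𝒜} (hS : HomFromShortExact C S) :
    (kbToDsg C).obj (coneKb S.f) ≅ (toDsg C).obj S.X₃ :=
  (Qsg C).mapIso (Localization.isoOfHom (Qb C) (acyclic C).trW _ (trW_coneDesc C hS))

/-- The image in `D_{C-sg}(𝒜)` of the third morphism of the mapping cone triangle. -/
def coneBoundary {X Y : 𝒜} (f : X ⟶ Y) :
    (kbToDsg C).obj (coneKb f) ⟶ ((toDsg C).obj X)⟦(1 : ℤ)⟧ :=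
  ((kbToDsg C).mapTriangle.obj (coneTriangle f)).mor₃

lemma coneBoundary_naturality {S S' : ShortComplex 𝒜} (φ : S ⟶ S') :
    coneBoundary C S.f ≫ ((toDsg C).map φ.τ₁)⟦(1 : ℤ)⟧' =
      (kbToDsg C).map (coneMap φ) ≫ coneBoundary C S'.f := by
  have h := (kbToDsg C).congr_map (coneMap_mor₃ φ)
  have h' := (kbToDsg C).commShiftIso_hom_naturality ((toKb 𝒜).map φ.τ₁) (1 : ℤ)
  change ((kbToDsg C).map _ ≫ ((kbToDsg C).commShiftIso (1 : ℤ)).hom.app _) ≫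
      ((kbToDsg C).map ((toKb 𝒜).map φ.τ₁))⟦(1 : ℤ)⟧' =
    (kbToDsg C).map _ ≫ (kbToDsg C).map _ ≫ ((kbToDsg C).commShiftIso (1 : ℤ)).hom.app _
  refine (Category.assoc _ _ _).trans ((congrArg (_ ≫ ·) h'.symm).trans ?_)
  refine (Category.assoc _ _ _).symm.trans (Eq.trans ?_ (Category.assoc _ _ _))
  refine congrArg (· ≫ _) ?_
  exact (Functor.map_comp _ _ _).symm.trans (h.symm.trans (Functor.map_comp _ _ _))

/-- The connecting morphism in `D_{C-sg}(𝒜)` of a `Hom(C, -)`-exact short complex. -/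
def connecting (S : ShortComplex 𝒜) (hS : HomFromShortExact C S) :
    (toDsg C).obj S.X₃ ⟶ ((toDsg C).obj S.X₁)⟦(1 : ℤ)⟧ :=
  (coneIso C hS).inv ≫ coneBoundary C S.f

lemma connecting_distinguished (S : ShortComplex 𝒜) (hS : HomFromShortExact C S) :
    Triangle.mk ((toDsg C).map S.f) ((toDsg C).map S.g) (connecting C S hS) ∈
      distTriang (Dsg C) := by
  let e : (kbToDsg C).mapTriangle.obj (coneTriangle S.f) ≅
      Triangle.mk ((toDsg C).map S.f) ((toDsg C).map S.g) (connecting C S hS) := by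
    refine Triangle.isoMk _ _ (Iso.refl _) (Iso.refl _) (coneIso C hS) ?_ ?_ ?_
    · exact (Category.comp_id _).trans (Category.id_comp _).symm
    · refine Eq.trans ?_ (Category.id_comp _).symm
      exact ((kbToDsg C).map_comp _ _).symm.trans
        (congrArg (kbToDsg C).map (coneTriangle_mor₂_coneDesc S))
    · refine Eq.trans ?_ ((coneIso C hS).hom_inv_id_assoc (coneBoundary C S.f)).symm
      exact (congrArg (_ ≫ ·) (CategoryTheory.Functor.map_id _ _)).trans (Category.comp_id _)
  exact isomorphic_distinguished _
    ((kbToDsg C).map_distinguished _ (coneTriangle_distinguished S.f)) _ e.symm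

lemma connecting_naturality {S S' : ShortComplex 𝒜} (hS : HomFromShortExact C S)
    (hS' : HomFromShortExact C S') (φ : S ⟶ S') :
    connecting C S hS ≫ ((toDsg C).map φ.τ₁)⟦(1 : ℤ)⟧' =
      (toDsg C).map φ.τ₃ ≫ connecting C S' hS' := by
  have h : (kbToDsg C).map (coneMap φ) ≫ (coneIso C hS').hom =
      (coneIso C hS).hom ≫ (toDsg C).map φ.τ₃ :=
    ((kbToDsg C).map_comp _ _).symm.trans
      (((kbToDsg C).congr_map (coneMap_coneDesc φ)).trans ((kbToDsg C).map_comp _ _))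
  rw [connecting, connecting, Category.assoc, coneBoundary_naturality, Iso.inv_comp_eq,
    ← Category.assoc (coneIso C hS).hom, ← h,
    Category.assoc, Iso.hom_inv_id_assoc]

end

/-! ### The functors on the Gorenstein category and its stable category -/

/-- The short complex of a chosen conflation `0 ⟶ M ⟶ I(M) ⟶ S(M) ⟶ 0`. -/
abbrev cosyzygySequence (M : Gor C) : ShortComplex 𝒜 :=
  ShortComplex.mk (cosyzygy C M).i (cosyzygy C M).p (cosyzygy C M).zero

lemma homFromShortExact_cosyzygySequence (M : Gor C) :
    HomFromShortExact C (cosyzygySequence C M) :=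
  homFromShortExact_of_exists_lift (cosyzygy C M).shortExact (cosyzygy C M).lift

/-- The pushout of a short exact sequence along a morphism out of its first object is short
exact. -/
lemma shortExact_of_isPushout {X I S Y Z : 𝒜} {i : X ⟶ I} {p : I ⟶ S} {zero : i ≫ p = 0}
    (h : (ShortComplex.mk i p zero).ShortExact) {u : X ⟶ Y} {t : I ⟶ Z} {v : Y ⟶ Z}
    (sq : IsPushout i u t v) {w : Z ⟶ S} (htw : t ≫ w = p) (hvw : v ≫ w = 0) :
    (ShortComplex.mk v w hvw).ShortExact := by
  have : Mono i := h.mono_f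
  have : Epi p := h.epi_g
  have hv : Mono v := (MorphismProperty.monomorphisms 𝒜).of_isPushout sq.flip ‹_›
  have hw : Epi w := by
    have : Epi (t ≫ w) := by rwa [htw]
    exact epi_of_epi t w
  refine { exact := ?_, mono_f := hv, epi_g := hw }
  refine ShortComplex.exact_of_g_is_cokernel _ (CokernelCofork.IsColimit.ofπ' w hvw ?_)
  intro A k hk
  have h0 : i ≫ t ≫ k = 0 := by rw [sq.w_assoc, hk, comp_zero]
  refine ⟨h.exact.desc _ h0, sq.hom_ext ?_ ?_⟩
  · rw [reassoc_of% htw]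
    exact h.exact.g_desc _ h0
  · rw [reassoc_of% hvw, zero_comp, hk]

variable [C.IsClosedUnderFiniteProducts]

instance : (theta C).Additive := by
  unfold theta
  infer_instance

theorem isDeltaFunctor_theta : IsDeltaFunctor C (theta C) :=
  ⟨inferInstance, fun S hS => connecting C (S.map (gorenstein C).ι) hS,
    fun S hS => connecting_distinguished C (S.map (gorenstein C).ι) hS,
    fun S S' hS hS' φ => connecting_naturality C (S := S.map (gorenstein C).ι)
      (S' := S'.map (gorenstein C).ι) hS hS' ((gorenstein C).ι.mapShortComplex.map φ)⟩

/-- The connecting morphism `θ(S(M)) ⟶ θ(M)[1]` of `0 ⟶ M ⟶ I(M) ⟶ S(M) ⟶ 0`. -/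
def cosyzygyConnecting (M : Gor C) :
    (theta C).obj (cosyzygy C M).cosyz ⟶ ((theta C).obj M)⟦(1 : ℤ)⟧ :=
  connecting C _ (homFromShortExact_cosyzygySequence C M)

instance (M : Gor C) : IsIso (cosyzygyConnecting C M) :=
  (Triangle.isZero₂_iff_isIso₃ _ (connecting_distinguished C _
    (homFromShortExact_cosyzygySequence C M))).1 (isZero_toDsg C (cosyzygy C M).prop_I)

lemma cosyzygyConnecting_naturality {M N : Gor C} (f : M ⟶ N) :
    cosyzygyConnecting C M ≫ ((theta C).map f)⟦(1 : ℤ)⟧' =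
      (theta C).map (cosyzygyMap C f) ≫ cosyzygyConnecting C N := by
  obtain ⟨a, ha, hb⟩ := cosyzygyMap_spec C f
  let φ : cosyzygySequence C M ⟶ cosyzygySequence C N :=
    { τ₁ := f.hom, τ₂ := a, τ₃ := (cosyzygyMap C f).hom, comm₁₂ := ha.symm, comm₂₃ := hb.symm }
  exact connecting_naturality C (homFromShortExact_cosyzygySequence C M)
    (homFromShortExact_cosyzygySequence C N) φ

/-- The isomorphism `θ(S(M)) ≅ θ(M)[1]`. It is the negative of the connecting morphism: with this
sign, standard triangles are sent to distinguished triangles. -/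
def suspensionIso (M : Gor C) :
    (theta C).obj (cosyzygy C M).cosyz ≅ ((theta C).obj M)⟦(1 : ℤ)⟧ where
  hom := -cosyzygyConnecting C M
  inv := -inv (cosyzygyConnecting C M)
  hom_inv_id := (Preadditive.neg_comp_neg _ _).trans (IsIso.hom_inv_id _)
  inv_hom_id := (Preadditive.neg_comp_neg _ _).trans (IsIso.inv_hom_id _)

lemma suspensionIso_hom (M : Gor C) : (suspensionIso C M).hom = -cosyzygyConnecting C M := rfl

lemma suspensionIso_naturality {M N : Gor C} (f : M ⟶ N) :
    (theta C).map (cosyzygyMap C f) ≫ (suspensionIso C N).hom =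
      (suspensionIso C M).hom ≫ ((theta C).map f)⟦(1 : ℤ)⟧' := by
  rw [suspensionIso_hom, suspensionIso_hom, Preadditive.comp_neg, Preadditive.neg_comp,
    cosyzygyConnecting_naturality]

/-- The natural isomorphism `θ' ∘ S ≅ [1] ∘ θ'`. -/
def suspensionNatIso :
    suspension C ⋙ thetaStable C ≅ thetaStable C ⋙ shiftFunctor (Dsg C) (1 : ℤ) :=
  CategoryTheory.Quotient.natIsoLift (stableRel C)
    (NatIso.ofComponents (fun M => suspensionIso C M) (fun f => suspensionIso_naturality C f))

/-- The image under `θ` of a standard triangle is distinguished. -/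
lemma theta_distinguished_of_isStandard {X Y Z : Gor C} {u : X ⟶ Y} {v : Y ⟶ Z}
    {w : Z ⟶ (cosyzygy C X).cosyz} (h : IsStandard C u v w) :
    Triangle.mk ((theta C).map u) ((theta C).map v) ((theta C).map w ≫ (suspensionIso C X).hom) ∈
      distTriang (Dsg C) := by
  obtain ⟨t, sq, htw, hvw⟩ := h
  have hvw' : v.hom ≫ w.hom = 0 := congrArg (·.hom) hvw
  have hS : HomFromShortExact C (ShortComplex.mk v.hom w.hom hvw') := by
    refine homFromShortExact_of_exists_lift
      (shortExact_of_isPushout (cosyzygy C X).shortExact sq htw hvw') fun A hA f => ?_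
    obtain ⟨g, hg⟩ := (cosyzygy C X).lift hA f
    exact ⟨g ≫ t, by rw [← hg, ← htw, Category.assoc]⟩
  let φ : cosyzygySequence C X ⟶ ShortComplex.mk v.hom w.hom hvw' :=
    { τ₁ := u.hom
      τ₂ := t
      τ₃ := 𝟙 _
      comm₁₂ := sq.w.symm
      comm₂₃ := htw.trans (Category.comp_id _).symm }
  have hφ : cosyzygyConnecting C X ≫ ((theta C).map u)⟦(1 : ℤ)⟧' = connecting C _ hS :=
    (connecting_naturality C (homFromShortExact_cosyzygySequence C X) hS φ).trans
      ((congrArg (· ≫ _) ((toDsg C).map_id _)).trans (Category.id_comp _))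
  rw [Pretriangulated.rotate_distinguished_triangle]
  refine isomorphic_distinguished _ (connecting_distinguished C _ hS) _ (Iso.symm ?_)
  refine Triangle.isoMk _ _ (Iso.refl _) (Iso.refl _) (suspensionIso C X) ?_ ?_ ?_
  · exact (Category.comp_id _).trans (Category.id_comp _).symm
  · exact (Category.id_comp _).symm
  · refine (congrArg (_ ≫ ·) (CategoryTheory.Functor.map_id _ _)).trans ?_
    refine (Category.comp_id _).trans (hφ.symm.trans ?_)
    exact (Preadditive.neg_comp_neg _ _).symm

instance : (thetaStable C).Additive where
  map_add {X Y f g} := by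
    obtain ⟨f, rfl⟩ := (toStable C).map_surjective f
    obtain ⟨g, rfl⟩ := (toStable C).map_surjective g
    rw [← Functor.map_add]
    exact (theta C).map_add

theorem isTriangleFunctor_thetaStable : IsTriangleFunctor C (thetaStable C) := by
  refine ⟨inferInstance, suspensionNatIso C, ?_⟩
  rintro X Y Z u v w ⟨X', Y', Z', u', v', w', h, a, b, c, hu, hv, hw⟩
  refine isomorphic_distinguished _ (theta_distinguished_of_isStandard C h) _
    (Triangle.isoMk _ _ ((thetaStable C).mapIso a) ((thetaStable C).mapIso b)
      ((thetaStable C).mapIso c) ?_ ?_ ?_)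
  · exact ((thetaStable C).map_comp _ _).symm.trans
      (((thetaStable C).congr_map hu).trans ((thetaStable C).map_comp _ _))
  · exact ((thetaStable C).map_comp _ _).symm.trans
      (((thetaStable C).congr_map hv).trans ((thetaStable C).map_comp _ _))
  · have hn := (suspensionNatIso C).hom.naturality a.hom
    have hw' : (thetaStable C).map w ≫ (thetaStable C).map ((suspension C).map a.hom) =
        (thetaStable C).map c.hom ≫ (theta C).map w' :=
      ((thetaStable C).map_comp _ _).symm.trans
        (((thetaStable C).congr_map hw).trans ((thetaStable C).map_comp _ _))
    refine (Category.assoc _ _ _).trans ((congrArg (_ ≫ ·) hn.symm).trans ?_)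
    refine (Category.assoc _ _ _).symm.trans ((congrArg (· ≫ _) hw').trans ?_)
    exact Category.assoc _ _ _

end RelSing

end

theorem proposition4p10 {k : Type*} [Field k] {A : Type u} [Ring A] [Algebra k A]
    [Module.Finite k A] (C : ObjectProperty (FGModuleCat.{u} A))
    [C.IsClosedUnderFiniteProducts] [C.IsStableUnderRetracts] (hC : RelSing.IsAdmissible C) :
    haveI : IsNoetherianRing A := IsNoetherianRing.of_finite k A
    RelSing.IsDeltaFunctor C (RelSing.theta C) ∧
    (∀ M : RelSing.Gor C, C M.obj → IsZero ((RelSing.theta C).obj M)) ∧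
    RelSing.IsTriangleFunctor C (RelSing.thetaStable C) := by
  have : IsNoetherianRing A := IsNoetherianRing.of_finite k A
  exact ⟨RelSing.isDeltaFunctor_theta C, fun _ hM => RelSing.isZero_toDsg C hM,
    RelSing.isTriangleFunctor_thetaStable C⟩
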